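/- Let $B$ be a separable real Banach space, let $n\ge 1$, and let $X_1,\dots,X_n$ be independent, identically distributed $B$-valued random variables with $\|X_1\|\le 1$ almost surely. Let $\varepsilon_1,\dots,\varepsilon_n$ be independent Rademacher random variables ($\mathbf P(\varepsilon_i=1)=\mathbf P(\varepsilon_i=-1)=\tfrac12$) such that the family $(\varepsilon_1,\dots,\varepsilon_n)$ is independent of $(X_1,\dots,X_n)$, and let $$R=\mathbf E\Big[\,\Big\|\sum_{i=1}^n\varepsilon_iX_i\Big\|\ \Big|\ X_1,\dots,X_n\Big]$$ be the conditional Rademacher average. Then $$\operatorname{Var}(R)\le \mathbf E[R],$$ and, for every $t>0$, $$\mathbf P\big(R-\mathbf E[R]\ge t\big)\le \exp\left\{-\frac{t^2}{2\big(\operatorname{Var}(R)+\frac{2^{3/2}}{3}\,t\sqrt n\big)}\right\}.$$ Moreover, the last inequality also holds with $R$ replaced by $-R$, that is, $\mathbf P\big(-R+\mathbf E[R]\ge t\big)$ has the same upper bound for every $t>0$. -/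

import Mathlib

open MeasureTheory ProbabilityTheory

/-- A Rademacher (symmetric random sign) variable: it takes each of the values `1` and `-1`
with probability `1/2`. -/
structure IsRademacher {Ω : Type*} [MeasurableSpace Ω] (μ : Measure Ω) (e : Ω → ℝ) : Prop where
  measurable : Measurable e
  prob_one : μ {ω | e ω = 1} = 1 / 2
  prob_neg_one : μ {ω | e ω = -1} = 1 / 2

/-- The conditional Rademacher average `R = E[‖∑ i, ε i • X i‖ | X 1, …, X n]`: the conditional
expectation given the `σ`-algebra generated by the whole family `X`. -/
noncomputable def condRademacherAverage {Ω : Type*} [MeasurableSpace Ω] (μ : Measure Ω)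
    {B : Type*} [NormedAddCommGroup B] [NormedSpace ℝ B] [MeasurableSpace B] {n : ℕ}
    (X : Fin n → Ω → B) (ε : Fin n → Ω → ℝ) : Ω → ℝ :=
  μ[fun ω => ‖∑ i, ε i ω • X i ω‖ | ⨆ i, MeasurableSpace.comap (X i) inferInstance]

/-! ### Concentration on product spaces: Efron–Stein and bounded differences. -/

section ProductSpace

variable {α : Type*} [MeasurableSpace α]

/-! By independence of signs and vectors, `R` is almost surely `f(X)`, where `f(x)` averages `‖∑ s i
• x i‖` over random signs. Let `f_i` be `f` with the `i`-th vector replaced by `0`. On the unit ball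
`0 ≤ f - f_i ≤ 1` and `∑ (f - f_i) ≤ f`, so `f` is self-bounding. As `f_i` ignores coordinate `i`,
`efronStein_pi` gives `Var f ≤ ∑ E(f - f_i)² ≤ ∑ E(f - f_i) ≤ E f`.

The tail bound needs no entropy argument. Changing one coordinate moves `f` by at most 1, so `f - E
f` is sub-Gaussian with constant `n`. With `c = 2^(3/2)/3`, Cantelli's inequality suffices for `t ≤
2c√n`, and the sub-Gaussian tail `exp(-t²/(2n))` suffices beyond. Both ingredients are unchanged
under `R ↦ -R`, which gives the lower tail. -/

theorem integrable_of_abs_le {Ω : Type*} [MeasurableSpace Ω] {μ : Measure Ω} [IsFiniteMeasure μ]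
    {f : Ω → ℝ} (hf : Measurable f) {C : ℝ} (hC : ∀ x, |f x| ≤ C) : Integrable f μ :=
  Integrable.of_bound hf.aestronglyMeasurable C (ae_of_all _ hC)

theorem abs_integral_le_of_abs_le {Ω : Type*} [MeasurableSpace Ω] {μ : Measure Ω}
    [IsProbabilityMeasure μ] {f : Ω → ℝ} {C : ℝ} (hC : ∀ x, |f x| ≤ C) : |∫ x, f x ∂μ| ≤ C := by
  simpa using norm_integral_le_of_norm_le_const (μ := μ) (f := f) (C := C) (ae_of_all _ hC)

theorem measurable_fin_cons {n : ℕ} :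
    Measurable fun p : α × (Fin n → α) => (Fin.cons p.1 p.2 : Fin (n + 1) → α) := by
  refine measurable_pi_iff.2 fun i => ?_
  refine Fin.cases ?_ (fun j => ?_) i
  · simpa using measurable_fst
  · simpa [Function.comp_def] using (measurable_pi_apply j).comp measurable_snd

theorem measurePreserving_fin_cons {n : ℕ} (ν : Fin (n + 1) → Measure α)
    [∀ i, IsProbabilityMeasure (ν i)] :
    MeasurePreserving (fun p : α × (Fin n → α) => (Fin.cons p.1 p.2 : Fin (n + 1) → α))
      ((ν 0).prod (Measure.pi fun j => ν j.succ)) (Measure.pi ν) := by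
  have h := (measurePreserving_piFinSuccAbove ν 0).symm
  simp only [Fin.zero_succAbove] at h
  convert h using 1
  ext p i
  simp [MeasurableEquiv.piFinSuccAbove, Fin.consEquiv]

/-- Fubini for a product of `n + 1` probability measures, splitting off the first coordinate. -/
theorem integral_pi_fin_succ {n : ℕ} (ν : Fin (n + 1) → Measure α)
    [∀ i, IsProbabilityMeasure (ν i)] {f : (Fin (n + 1) → α) → ℝ} (hf : Measurable f)
    {C : ℝ} (hC : ∀ x, |f x| ≤ C) :
    ∫ x, f x ∂Measure.pi ν =
      ∫ a, ∫ y, f (Fin.cons a y) ∂(Measure.pi fun j => ν j.succ) ∂ν 0 := by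
  have h := measurePreserving_fin_cons ν
  rw [← h.map_eq, integral_map h.measurable.aemeasurable hf.aestronglyMeasurable]
  exact integral_prod _ (integrable_of_abs_le (hf.comp h.measurable) fun x => hC _)

theorem measurable_integral_fin_cons {n : ℕ} (ν : Measure (Fin n → α)) [IsProbabilityMeasure ν]
    {f : (Fin (n + 1) → α) → ℝ} (hf : Measurable f) :
    Measurable fun a => ∫ y, f (Fin.cons a y) ∂ν :=
  ((hf.comp measurable_fin_cons).stronglyMeasurable.integral_prod_right').measurable

theorem sq_integral_le_integral_sq {Ω : Type*} [MeasurableSpace Ω] {μ : Measure Ω}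
    [IsProbabilityMeasure μ] {f : Ω → ℝ} (hf : Measurable f) {C : ℝ} (hC : ∀ x, |f x| ≤ C) :
    (∫ x, f x ∂μ) ^ 2 ≤ ∫ x, f x ^ 2 ∂μ := by
  have hL : MemLp f 2 μ := MemLp.of_bound hf.aestronglyMeasurable C (ae_of_all _ hC)
  have h := variance_nonneg f μ
  rw [variance_eq_sub hL] at h
  simpa using h

/-- The bias-variance decomposition. -/
theorem integral_sub_const_sq {Ω : Type*} [MeasurableSpace Ω] {μ : Measure Ω}
    [IsProbabilityMeasure μ] {f : Ω → ℝ} (hf : MemLp f 2 μ) (m : ℝ) :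
    ∫ x, (f x - m) ^ 2 ∂μ = ∫ x, (f x - ∫ y, f y ∂μ) ^ 2 ∂μ + (∫ y, f y ∂μ - m) ^ 2 := by
  have h1 : ∀ c : ℝ, ∫ x, (f x - c) ^ 2 ∂μ = ∫ x, f x ^ 2 ∂μ - 2 * c * ∫ x, f x ∂μ + c ^ 2 := by
    intro c
    have hi : Integrable f μ := hf.integrable (by norm_num)
    have : ∀ x, (f x - c) ^ 2 = f x ^ 2 - 2 * c * f x + c ^ 2 := fun x => by ring
    simp_rw [this]
    have hs : Integrable (fun x => f x ^ 2 - 2 * c * f x) μ :=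
      hf.integrable_sq.sub (hi.const_mul _)
    rw [integral_add hs (integrable_const _),
      integral_sub hf.integrable_sq (hi.const_mul _), integral_const_mul]
    simp
  rw [h1, h1]; ring

theorem abs_sub_sq_le {a b C D : ℝ} (ha : |a| ≤ C) (hb : |b| ≤ D) :
    |(a - b) ^ 2| ≤ (C + D) ^ 2 := by
  rw [abs_pow]
  exact pow_le_pow_left₀ (abs_nonneg _) ((abs_sub a b).trans (add_le_add ha hb)) 2

/-- The **Efron–Stein inequality** with the `i`-th conditional variance replaced by the mean square
distance to a function that does not depend on the `i`-th coordinate. -/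
theorem efronStein_pi (n : ℕ) (ν : Fin n → Measure α) [∀ i, IsProbabilityMeasure (ν i)]
    {f : (Fin n → α) → ℝ} (hf : Measurable f) {C : ℝ} (hC : ∀ x, |f x| ≤ C)
    {g : Fin n → (Fin n → α) → ℝ} (hg : ∀ i, Measurable (g i)) (hgC : ∀ i x, |g i x| ≤ C)
    (hgi : ∀ i x a, g i (Function.update x i a) = g i x) :
    ∫ x, (f x - ∫ y, f y ∂Measure.pi ν) ^ 2 ∂Measure.pi ν ≤
      ∑ i, ∫ x, (f x - g i x) ^ 2 ∂Measure.pi ν := by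
  induction n with
  | zero =>
    have : ∀ x, f x = f Fin.elim0 := fun x => congrArg f (Subsingleton.elim _ _)
    simp [this]
  | succ n ih =>
    set π := Measure.pi fun j : Fin n => ν j.succ with hπ
    have hmc : ∀ a, Measurable fun y : Fin n → α => (Fin.cons a y : Fin (n + 1) → α) := fun a =>
      measurable_fin_cons.comp measurable_prodMk_left
    set F : α → ℝ := fun a => ∫ y, f (Fin.cons a y) ∂π with hF
    have hFm : Measurable F := measurable_integral_fin_cons π hf
    have hFC : ∀ a, |F a| ≤ C := fun a => abs_integral_le_of_abs_le fun y => hC _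
    set m := ∫ y, f y ∂Measure.pi ν with hm
    have hmF : m = ∫ a, F a ∂ν 0 := integral_pi_fin_succ ν hf hC
    have hmC : |m| ≤ C := abs_integral_le_of_abs_le hC
    have hsm : ∀ i, Measurable fun x => (f x - g i x) ^ 2 := fun i => (hf.sub (hg i)).pow_const 2
    have hsC : ∀ i x, |(f x - g i x) ^ 2| ≤ (C + C) ^ 2 := fun i x =>
      abs_sub_sq_le (hC x) (hgC i x)
    -- The base point is arbitrary: `g 0` ignores its first coordinate, so `c` is simply its mean
    -- over the others.
    obtain ⟨a₀⟩ : Nonempty α := nonempty_of_isProbabilityMeasure (ν 0)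
    set c := ∫ y, g 0 (Fin.cons a₀ y) ∂π with hc
    have hcC : |c| ≤ C := abs_integral_le_of_abs_le fun y => hgC _ _
    have hg0 : ∀ a y, g 0 (Fin.cons a y) = g 0 (Fin.cons a₀ y) := by
      intro a y
      rw [← Fin.update_cons_zero (α := fun _ => α) a₀ y a, hgi]
    have hsint : ∀ i, Integrable (fun a => ∫ y, (f (Fin.cons a y) - g i (Fin.cons a y)) ^ 2 ∂π)
        (ν 0) := fun i =>
      integrable_of_abs_le (measurable_integral_fin_cons π (hsm i))
        fun a => abs_integral_le_of_abs_le fun y => hsC i _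
    have hFint : ∀ d, |d| ≤ C → Integrable (fun a => (F a - d) ^ 2) (ν 0) := fun d hd =>
      integrable_of_abs_le ((hFm.sub_const d).pow_const 2) fun a => abs_sub_sq_le (hFC a) hd
    -- With `a` frozen, split the square around the partial mean `F a`; induction bounds the
    -- fluctuation in the other coordinates.
    have hinner : ∀ a, ∫ y, (f (Fin.cons a y) - m) ^ 2 ∂π ≤
        ∑ i : Fin n, ∫ y, (f (Fin.cons a y) - g i.succ (Fin.cons a y)) ^ 2 ∂π + (F a - m) ^ 2 := by
      intro a
      rw [integral_sub_const_sq (f := fun y => f (Fin.cons a y)) (MemLp.of_bound (hf.comp (hmc a)).aestronglyMeasurable C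
        (ae_of_all _ fun y => hC _))]
      gcongr
      exact ih (fun j => ν j.succ) (hf.comp (hmc a)) (fun y => hC _)
        (g := fun i y => g i.succ (Fin.cons a y)) (fun i => (hg _).comp (hmc a))
        (fun i y => hgC _ _) (fun i y b => by
          simp only [Fin.cons_update, hgi])
    have houter : ∫ a, (F a - m) ^ 2 ∂ν 0 ≤
        ∫ a, ∫ y, (f (Fin.cons a y) - g 0 (Fin.cons a y)) ^ 2 ∂π ∂ν 0 := by
      -- The mean `m` of `F` is its best constant approximation, so it beats `c`; Jensen over `y`
      -- then gives the claim.
      calc ∫ a, (F a - m) ^ 2 ∂ν 0 ≤ ∫ a, (F a - c) ^ 2 ∂ν 0 := by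
            rw [integral_sub_const_sq (m := c) (MemLp.of_bound hFm.aestronglyMeasurable C
              (ae_of_all _ hFC)), ← hmF]
            linarith [sq_nonneg (m - c)]
        _ ≤ _ := by
            refine integral_mono (hFint c hcC) (hsint 0) fun a => ?_
            have : F a - c = ∫ y, (f (Fin.cons a y) - g 0 (Fin.cons a y)) ∂π := by
              rw [integral_sub (f := fun y => f (Fin.cons a y)) (g := fun y => g 0 (Fin.cons a y))
                (integrable_of_abs_le (hf.comp (hmc a)) fun y => hC _)
                (integrable_of_abs_le ((hg 0).comp (hmc a)) fun y => hgC _ _)]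
              simp only [hg0 a]
              rfl
            change (F a - c) ^ 2 ≤ _
            rw [this]
            exact sq_integral_le_integral_sq ((hf.sub (hg 0)).comp (hmc a)) (C := C + C)
              fun y => (abs_sub _ _).trans (add_le_add (hC _) (hgC _ _))
    rw [integral_pi_fin_succ ν (f := fun x => (f x - m) ^ 2) ((hf.sub_const m).pow_const 2)
      (fun x => abs_sub_sq_le (hC x) hmC), Fin.sum_univ_succ]
    simp_rw [fun i => integral_pi_fin_succ ν (hsm i) (hsC i)]
    calc ∫ a, ∫ y, (f (Fin.cons a y) - m) ^ 2 ∂π ∂ν 0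
        ≤ ∫ a, (∑ i : Fin n, ∫ y, (f (Fin.cons a y) - g i.succ (Fin.cons a y)) ^ 2 ∂π
            + (F a - m) ^ 2) ∂ν 0 := by
          refine integral_mono ?_ ((integrable_finsetSum _ fun i _ => hsint i.succ).add
            (hFint m hmC)) hinner
          exact integrable_of_abs_le
            (measurable_integral_fin_cons π (f := fun x => (f x - m) ^ 2)
              ((hf.sub_const m).pow_const 2))
            fun a => abs_integral_le_of_abs_le fun y => abs_sub_sq_le (hC _) hmC
      _ = ∑ i : Fin n, ∫ a, ∫ y, (f (Fin.cons a y) - g i.succ (Fin.cons a y)) ^ 2 ∂π ∂ν 0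
            + ∫ a, (F a - m) ^ 2 ∂ν 0 := by
          rw [integral_add (integrable_finsetSum _ fun i _ => hsint i.succ) (hFint m hmC),
            integral_finsetSum _ fun i _ => hsint i.succ]
      _ ≤ _ := by rw [add_comm]; gcongr

/-- The exponential moment bound behind the **bounded differences inequality**. -/
theorem integral_exp_sub_integral_pi_le (n : ℕ) (ν : Fin n → Measure α)
    [∀ i, IsProbabilityMeasure (ν i)] {f : (Fin n → α) → ℝ} (hf : Measurable f) {C : ℝ}
    (hC : ∀ x, |f x| ≤ C)
    (hosc : ∀ i x a b, f (Function.update x i a) - f (Function.update x i b) ≤ 1) (t : ℝ) :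
    ∫ x, Real.exp (t * (f x - ∫ y, f y ∂Measure.pi ν)) ∂Measure.pi ν ≤
      Real.exp (n * t ^ 2 / 2) := by
  induction n with
  | zero =>
    have : ∀ x, f x = f Fin.elim0 := fun x => congrArg f (Subsingleton.elim _ _)
    simp [this]
  | succ n ih =>
    set π := Measure.pi fun j : Fin n => ν j.succ with hπ
    have hmc : ∀ a, Measurable fun y : Fin n → α => (Fin.cons a y : Fin (n + 1) → α) := fun a =>
      measurable_fin_cons.comp measurable_prodMk_left
    set F : α → ℝ := fun a => ∫ y, f (Fin.cons a y) ∂π with hF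
    have hFm : Measurable F := measurable_integral_fin_cons π hf
    have hFC : ∀ a, |F a| ≤ C := fun a => abs_integral_le_of_abs_le fun y => hC _
    set m := ∫ y, f y ∂Measure.pi ν with hm
    have hmF : m = ∫ a, F a ∂ν 0 := integral_pi_fin_succ ν hf hC
    have hmC : |m| ≤ C := abs_integral_le_of_abs_le hC
    have hexp : ∀ {u d : ℝ}, |u| ≤ C → |d| ≤ C →
        |Real.exp (t * (u - d))| ≤ Real.exp (|t| * (C + C)) := by
      intro u d hu hd
      rw [Real.abs_exp, Real.exp_le_exp]
      refine (le_abs_self _).trans ?_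
      rw [abs_mul]
      gcongr
      exact (abs_sub _ _).trans (add_le_add hu hd)
    have hsub : ∀ a b, F a - F b ≤ 1 := by
      intro a b
      have hint : ∀ a, Integrable (fun y => f (Fin.cons a y)) π := fun a =>
        integrable_of_abs_le (hf.comp (hmc a)) fun y => hC _
      rw [hF]
      dsimp only
      rw [← integral_sub (hint a) (hint b)]
      refine (integral_mono ((hint a).sub (hint b)) (integrable_const (1 : ℝ)) fun y => ?_).trans
        (by simp)
      simpa using! hosc 0 (Fin.cons a y) a b
    obtain ⟨a₀⟩ : Nonempty α := nonempty_of_isProbabilityMeasure (ν 0)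
    -- Hoeffding's lemma on an interval of length 2 centred at `F a₀` gives constant 1. The sharp
    -- 1/4 is not needed.
    have hsg := (hasSubgaussianMGF_of_mem_Icc (μ := ν 0) (a := F a₀ - 1) (b := F a₀ + 1)
      hFm.aemeasurable (ae_of_all _ fun a => ⟨by linarith [hsub a₀ a], by linarith [hsub a a₀]⟩)).mgf_le t
    have hconst : (((‖F a₀ + 1 - (F a₀ - 1)‖₊ / 2) ^ 2 : NNReal) : ℝ) = 1 := by
      have : F a₀ + 1 - (F a₀ - 1) = 2 := by ring
      rw [this]; norm_num
    rw [hconst, ← hmF, mgf] at hsg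
    have hEm : Measurable fun x => Real.exp (t * (f x - m)) := by fun_prop
    rw [integral_pi_fin_succ ν hEm fun x => hexp (hC x) hmC]
    have hpt : ∀ a, ∫ y, Real.exp (t * (f (Fin.cons a y) - m)) ∂π ≤
        Real.exp (n * t ^ 2 / 2) * Real.exp (t * (F a - m)) := by
      intro a
      have h1 := ih (fun j => ν j.succ) (hf.comp (hmc a)) (fun y => hC _)
        (fun i y b c => by simpa using! hosc i.succ (Fin.cons a y) b c)
      have h2 : ∀ y, Real.exp (t * (f (Fin.cons a y) - m)) =
          Real.exp (t * (f (Fin.cons a y) - F a)) * Real.exp (t * (F a - m)) := fun y => by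
        rw [← Real.exp_add]; ring_nf
      simp_rw [h2]
      rw [integral_mul_const]
      gcongr
      exact h1
    calc _ ≤ ∫ a, Real.exp (n * t ^ 2 / 2) * Real.exp (t * (F a - m)) ∂ν 0 := by
          refine integral_mono ?_ ?_ hpt
          · exact integrable_of_abs_le (measurable_integral_fin_cons π hEm)
              fun a => abs_integral_le_of_abs_le fun y => hexp (hC _) hmC
          · exact (integrable_of_abs_le (by fun_prop) fun a => hexp (hFC a) hmC).const_mul _
      _ ≤ Real.exp (n * t ^ 2 / 2) * Real.exp (1 * t ^ 2 / 2) := by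
          rw [integral_const_mul]
          gcongr
      _ = _ := by
          rw [← Real.exp_add]; push_cast; ring_nf

theorem hasSubgaussianMGF_pi_of_bounded_differences {n : ℕ} (ν : Fin n → Measure α)
    [∀ i, IsProbabilityMeasure (ν i)] {f : (Fin n → α) → ℝ} (hf : Measurable f) {C : ℝ}
    (hC : ∀ x, |f x| ≤ C)
    (hosc : ∀ i x a b, f (Function.update x i a) - f (Function.update x i b) ≤ 1) :
    HasSubgaussianMGF (fun x => f x - ∫ y, f y ∂Measure.pi ν) n (Measure.pi ν) where
  integrable_exp_mul t := by
    refine integrable_exp_mul_of_mem_Icc (a := -C - ∫ y, f y ∂Measure.pi ν)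
      (b := C - ∫ y, f y ∂Measure.pi ν) (by fun_prop) (ae_of_all _ fun x => ?_)
    have := abs_le.1 (hC x)
    constructor <;> linarith
  mgf_le t := by
    simpa [mgf] using integral_exp_sub_integral_pi_le n ν hf hC hosc t

end ProductSpace

/-! ### From variance and sub-Gaussian constant to a Bernstein-type tail. -/

section Tail

variable {Ω : Type*} [MeasurableSpace Ω] {μ : Measure Ω} [IsProbabilityMeasure μ]

/-- **Cantelli's inequality**, the one-sided Chebyshev inequality. -/
theorem measureReal_le_sub_integral_le_variance_div {Y : Ω → ℝ} (hY : MemLp Y 2 μ) {t : ℝ}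
    (ht : 0 < t) :
    μ.real {ω | t ≤ Y ω - ∫ ω', Y ω' ∂μ} ≤ variance Y μ / (variance Y μ + t ^ 2) := by
  set m := ∫ ω', Y ω' ∂μ with hm
  set V := variance Y μ with hV
  have hV0 : 0 ≤ V := variance_nonneg _ _
  -- The shift that minimises the Markov bound `(V + u²) / (t + u)²`.
  set u := V / t with hu
  have hu0 : 0 ≤ u := div_nonneg hV0 ht.le
  have hL : MemLp (fun ω => Y ω - (m - u)) 2 μ := hY.sub (memLp_const _)
  have hint : ∫ ω, (Y ω - (m - u)) ^ 2 ∂μ = V + u ^ 2 := by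
    have hi : Integrable Y μ := hY.integrable (by norm_num)
    have h1 := variance_eq_sub hL
    rw [variance_sub_const hY.aestronglyMeasurable] at h1
    have h2 : ∫ ω, (Y ω - (m - u)) ∂μ = u := by
      rw [integral_sub hi (integrable_const _)]
      simp [← hm]
    rw [h2] at h1
    simp only [Pi.pow_apply] at h1
    linarith
  have hM := mul_meas_ge_le_integral_of_nonneg (μ := μ) (f := fun ω => (Y ω - (m - u)) ^ 2)
    (ae_of_all _ fun ω => sq_nonneg _) hL.integrable_sq ((t + u) ^ 2)
  rw [hint] at hM
  have hsub : μ.real {ω | t ≤ Y ω - m} ≤ μ.real {ω | (t + u) ^ 2 ≤ (Y ω - (m - u)) ^ 2} := by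
    refine measureReal_mono fun ω hω => ?_
    simp only [Set.mem_ofPred_eq] at hω ⊢
    exact pow_le_pow_left₀ (by positivity) (by linarith) 2
  have hpos : 0 < (t + u) ^ 2 := by positivity
  have h3 : μ.real {ω | t ≤ Y ω - m} ≤ (V + u ^ 2) / (t + u) ^ 2 := by
    rw [le_div_iff₀ hpos]
    calc _ ≤ μ.real {ω | (t + u) ^ 2 ≤ (Y ω - (m - u)) ^ 2} * (t + u) ^ 2 := by gcongr
      _ ≤ _ := by rw [mul_comm]; exact hM
  refine h3.trans_eq ?_
  rw [hu]
  field_simp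
  rw [add_comm]

/-- A square integrable variable with sub-Gaussian constant `n` satisfies a Bernstein type bound
with its variance and a linear term of order `√n`. -/
theorem measureReal_le_exp_of_hasSubgaussianMGF {Y : Ω → ℝ} (hY : MemLp Y 2 μ) {n : ℕ}
    (hn : 1 ≤ n) (hsg : HasSubgaussianMGF (fun ω => Y ω - ∫ ω', Y ω' ∂μ) n μ) {t : ℝ}
    (ht : 0 < t) :
    μ.real {ω | t ≤ Y ω - ∫ ω', Y ω' ∂μ} ≤
      Real.exp (-(t ^ 2 / (2 * (variance Y μ + (2 : ℝ) ^ (3 / 2 : ℝ) / 3 * t * √(n : ℝ))))) := by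
  set V := variance Y μ with hV
  have hV0 : 0 ≤ V := variance_nonneg _ _
  set c : ℝ := (2 : ℝ) ^ (3 / 2 : ℝ) / 3 with hc
  have hc0 : 0 < c := by positivity
  have hc2 : c ^ 2 = 8 / 9 := by
    rw [hc, div_pow, ← Real.rpow_natCast, ← Real.rpow_mul (by norm_num)]
    norm_num
  have hn0 : (0 : ℝ) < n := by exact_mod_cast hn
  set s := √(n : ℝ) with hs
  have hs0 : 0 < s := Real.sqrt_pos.2 hn0
  have hs2 : s ^ 2 = n := Real.sq_sqrt hn0.le
  have hD : 0 < c * t * s := by positivity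
  by_cases h : t ≤ 2 * c * s
  · refine (measureReal_le_sub_integral_le_variance_div hY ht).trans ?_
    -- In this range `t² ≤ 2cts`, so the target exponent is weak enough for Cantelli and `1 - x ≤
    -- exp (-x)`.
    have h1 : t ^ 2 / (2 * (V + c * t * s)) ≤ t ^ 2 / (2 * V + t ^ 2) := by
      gcongr
      nlinarith
    have h2 : V / (V + t ^ 2) ≤ 1 - t ^ 2 / (2 * V + t ^ 2) := by
      rw [one_sub_div (by positivity), div_le_div_iff₀ (by positivity) (by positivity)]
      nlinarith [mul_nonneg hV0 (sq_nonneg t)]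
    have h3 := Real.one_sub_le_exp_neg (t ^ 2 / (2 * (V + c * t * s)))
    linarith
  · push Not at h
    refine (hsg.measure_ge_le ht.le).trans ?_
    rw [Real.exp_le_exp, neg_div, neg_le_neg_iff]
    -- Here `cts ≥ 2c²n = 16n/9`, so the target denominator dominates `2n`.
    have h1 : (n : ℝ) ≤ V + c * t * s := by
      have : 2 * c * s * (c * s) ≤ t * (c * s) := by gcongr
      nlinarith
    simp only [NNReal.coe_natCast]
    gcongr

end Tail

/-! ### Random signs and their law. -/

/-- The law of a random sign. -/
noncomputable def rademacherMeasure : Measure ℝ :=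
  (1 / 2 : ENNReal) • Measure.dirac 1 + (1 / 2 : ENNReal) • Measure.dirac (-1)

instance : IsProbabilityMeasure rademacherMeasure :=
  ⟨by simp [rademacherMeasure, ENNReal.inv_two_add_inv_two]⟩

theorem ae_rademacherMeasure : ∀ᵐ s ∂rademacherMeasure, |s| = 1 := by
  have h : MeasurableSet {s : ℝ | |s| = 1} := measurableSet_eq_fun (by fun_prop) (by fun_prop)
  simp only [rademacherMeasure, ae_add_measure_iff]
  constructor <;> refine Measure.ae_smul_measure ?_ _ <;> rw [ae_dirac_iff h] <;> simp

theorem measurePreserving_neg_rademacherMeasure :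
    MeasurePreserving (fun s : ℝ => -s) rademacherMeasure rademacherMeasure := by
  refine ⟨measurable_neg, ?_⟩
  change Measure.map Neg.neg _ = _
  rw [rademacherMeasure, Measure.map_add _ _ measurable_neg, Measure.map_smul, Measure.map_smul,
    Measure.map_dirac' measurable_neg, Measure.map_dirac' measurable_neg, neg_neg, add_comm]

theorem IsRademacher.map_eq {Ω : Type*} [MeasurableSpace Ω] {μ : Measure Ω}
    [IsProbabilityMeasure μ] {e : Ω → ℝ} (he : IsRademacher μ e) :
    μ.map e = rademacherMeasure := by
  have := Measure.isProbabilityMeasure_map (μ := μ) he.measurable.aemeasurable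
  have hs : ∀ x, μ.map e {x} = μ {ω | e ω = x} := fun x =>
    Measure.map_apply he.measurable (measurableSet_singleton x)
  have hd : Disjoint ({1} : Set ℝ) {-1} := by
    rw [Set.disjoint_singleton]; norm_num
  have hu : μ.map e ({1} ∪ {-1}) = 1 := by
    rw [measure_union hd (measurableSet_singleton _), hs, hs, he.prob_one, he.prob_neg_one,
      ENNReal.add_halves]
  have hae : ∀ᵐ s ∂μ.map e, s ∈ ({1} ∪ {-1} : Set ℝ) := by
    rw [← prob_compl_eq_zero_iff (by measurability)] at hu
    exact hu
  rw [← Measure.restrict_eq_self_of_ae_mem hae, Measure.restrict_union hd (measurableSet_singleton _),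
    Measure.restrict_singleton, Measure.restrict_singleton, hs, hs, he.prob_one, he.prob_neg_one]
  rfl

/-! ### The Rademacher mean as a self-bounding function. -/

section RademacherMean

variable {B : Type*} [NormedAddCommGroup B] [NormedSpace ℝ B] {n : ℕ}

/-- The mean of `‖∑ i, s i • x i‖` over independent random signs `s`. -/
noncomputable def rademacherMean (x : Fin n → B) : ℝ :=
  ∫ s, ‖∑ i, s i • x i‖ ∂Measure.pi fun _ : Fin n => rademacherMeasure

theorem ae_pi_rademacherMeasure :
    ∀ᵐ s ∂Measure.pi fun _ : Fin n => rademacherMeasure, ∀ i, |s i| = 1 := by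
  rw [ae_all_iff]
  exact fun i => (measurePreserving_eval (fun _ : Fin n => rademacherMeasure) i)
    |>.quasiMeasurePreserving.ae ae_rademacherMeasure

theorem norm_sum_smul_le {s : Fin n → ℝ} (hs : ∀ i, |s i| = 1) (x : Fin n → B) :
    ‖∑ i, s i • x i‖ ≤ ∑ i, ‖x i‖ := by
  refine (norm_sum_le _ _).trans_eq (Finset.sum_congr rfl fun i _ => ?_)
  rw [norm_smul, Real.norm_eq_abs, hs, one_mul]

theorem integrable_norm_sum_smul (x : Fin n → B) :
    Integrable (fun s : Fin n → ℝ => ‖∑ i, s i • x i‖)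
      (Measure.pi fun _ : Fin n => rademacherMeasure) := by
  refine Integrable.of_bound ?_ (∑ i, ‖x i‖) ?_
  · exact (by fun_prop : Continuous fun s : Fin n → ℝ => ‖∑ i, s i • x i‖).aestronglyMeasurable
  · filter_upwards [ae_pi_rademacherMeasure] with s hs
    rw [norm_norm]
    exact norm_sum_smul_le hs x

theorem rademacherMean_nonneg (x : Fin n → B) : 0 ≤ rademacherMean x :=
  integral_nonneg fun _ => norm_nonneg _

theorem rademacherMean_le_sum_norm (x : Fin n → B) : rademacherMean x ≤ ∑ i, ‖x i‖ := by
  refine (integral_mono_ae (integrable_norm_sum_smul x)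
    (integrable_const (∑ i, ‖x i‖)) ?_).trans (by simp)
  filter_upwards [ae_pi_rademacherMeasure] with s hs using norm_sum_smul_le hs x

theorem sum_smul_update_zero (s : Fin n → ℝ) (x : Fin n → B) (i : Fin n) :
    ∑ j, s j • Function.update x i 0 j = ∑ j, s j • x j - s i • x i := by
  have : ∀ j, s j • Function.update x i 0 j = s j • x j - if j = i then s i • x i else 0 := by
    intro j
    by_cases h : j = i
    · subst h; simp
    · simp [h]
  simp [this]

theorem rademacherMean_le_update_zero_add (x : Fin n → B) (i : Fin n) :
    rademacherMean x ≤ rademacherMean (Function.update x i 0) + ‖x i‖ := by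
  have hi := integrable_norm_sum_smul (Function.update x i 0)
  calc rademacherMean x
      ≤ ∫ s, (‖∑ j, s j • Function.update x i 0 j‖ + ‖x i‖)
          ∂Measure.pi fun _ : Fin n => rademacherMeasure := by
        refine integral_mono_ae (integrable_norm_sum_smul x) (hi.add (integrable_const _)) ?_
        filter_upwards [ae_pi_rademacherMeasure] with s hs
        rw [sum_smul_update_zero]
        have h1 := norm_sub_norm_le (∑ j, s j • x j) (∑ j, s j • x j - s i • x i)
        rw [sub_sub_cancel, norm_smul, Real.norm_eq_abs, hs, one_mul] at h1
        linarith
    _ = _ := by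
        rw [integral_add hi (integrable_const _)]
        simp [rademacherMean]

theorem measurePreserving_flip_rademacherMeasure (i : Fin n) :
    MeasurePreserving (fun (s : Fin n → ℝ) j => if j = i then -s j else s j)
      (Measure.pi fun _ : Fin n => rademacherMeasure)
      (Measure.pi fun _ : Fin n => rademacherMeasure) := by
  refine measurePreserving_pi (f := fun j t => if j = i then -t else t) _ _ fun j => ?_
  by_cases h : j = i
  · simpa [h] using measurePreserving_neg_rademacherMeasure
  · simpa [h] using! MeasurePreserving.id rademacherMeasure

/-- Deleting the `i`-th term gives the midpoint of the sums with signs `s i` and `-s i`. Convexity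
of the norm and invariance of the law under this flip conclude. -/
theorem rademacherMean_update_zero_le (x : Fin n → B) (i : Fin n) :
    rademacherMean (Function.update x i 0) ≤ rademacherMean x := by
  set T : (Fin n → ℝ) → Fin n → ℝ := fun s j => if j = i then -s j else s j with hT
  have hTm := measurePreserving_flip_rademacherMeasure i
  have hsum : ∀ s, ∑ j, T s j • x j = ∑ j, s j • x j - (2 : ℝ) • s i • x i := by
    intro s
    have : ∀ j, T s j • x j = s j • x j - if j = i then (2 : ℝ) • s i • x i else 0 := by
      intro j
      by_cases h : j = i
      · subst h
        simp only [hT, if_true]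
        module
      · simp [hT, h]
    simp [this]
  have hflip : ∫ s, ‖∑ j, T s j • x j‖ ∂(Measure.pi fun _ : Fin n => rademacherMeasure) =
      rademacherMean x := by
    rw [rademacherMean]
    conv_rhs => rw [← hTm.map_eq]
    rw [integral_map hTm.measurable.aemeasurable]
    rw [hTm.map_eq]
    exact (integrable_norm_sum_smul x).aestronglyMeasurable
  have hTi : Integrable (fun s => ‖∑ j, T s j • x j‖)
      (Measure.pi fun _ : Fin n => rademacherMeasure) :=
    hTm.integrable_comp_of_integrable (integrable_norm_sum_smul x)
  have hx := integrable_norm_sum_smul x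
  calc rademacherMean (Function.update x i 0)
      ≤ ∫ s, (1 / 2 * ‖∑ j, s j • x j‖ + 1 / 2 * ‖∑ j, T s j • x j‖)
          ∂(Measure.pi fun _ : Fin n => rademacherMeasure) := by
        refine integral_mono (integrable_norm_sum_smul _)
          ((hx.const_mul _).add (hTi.const_mul _)) fun s => ?_
        have h : ∑ j, s j • Function.update x i 0 j =
            (1 / 2 : ℝ) • ∑ j, s j • x j + (1 / 2 : ℝ) • ∑ j, T s j • x j := by
          rw [sum_smul_update_zero, hsum]
          module
        simp only [h]
        refine (norm_add_le _ _).trans_eq ?_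
        simp [norm_smul]
    _ = rademacherMean x := by
        rw [integral_add (hx.const_mul _) (hTi.const_mul _), integral_const_mul,
          integral_const_mul, hflip, rademacherMean]
        ring

/-- For each choice of signs, the `n` leave-one-out sums add up to `(n - 1) • S`, so the triangle
inequality bounds their norms from below by `(n - 1) * ‖S‖` in total. -/
theorem sum_rademacherMean_sub_update_zero_le (x : Fin n → B) :
    ∑ i, (rademacherMean x - rademacherMean (Function.update x i 0)) ≤ rademacherMean x := by
  have hx := integrable_norm_sum_smul x
  have hi := fun i => hx.sub (integrable_norm_sum_smul (Function.update x i 0))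
  calc ∑ i, (rademacherMean x - rademacherMean (Function.update x i 0))
      = ∑ i, ∫ s, (‖∑ j, s j • x j‖ - ‖∑ j, s j • Function.update x i 0 j‖)
          ∂(Measure.pi fun _ : Fin n => rademacherMeasure) :=
        Finset.sum_congr rfl fun i _ => (integral_sub hx (integrable_norm_sum_smul _)).symm
    _ = ∫ s, ∑ i, (‖∑ j, s j • x j‖ - ‖∑ j, s j • Function.update x i 0 j‖)
          ∂(Measure.pi fun _ : Fin n => rademacherMeasure) :=
        (integral_finsetSum _ fun i _ => hi i).symm
    _ ≤ rademacherMean x := by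
        refine integral_mono (integrable_finsetSum _ fun i _ => hi i) hx fun s => ?_
        simp only [sum_smul_update_zero]
        set S := ∑ j, s j • x j with hS
        have h1 : ∑ i, (S - s i • x i) = ((n : ℝ) - 1) • S := by
          rw [Finset.sum_sub_distrib, ← hS, sub_smul, one_smul]
          simp [Nat.cast_smul_eq_nsmul]
        have h2 : ((n : ℝ) - 1) * ‖S‖ ≤ ∑ i, ‖S - s i • x i‖ := by
          refine le_trans ?_ (norm_sum_le _ _)
          rw [h1, norm_smul]
          -- The absolute value covers `n = 0`, where the factor is `-1`.
          exact mul_le_mul_of_nonneg_right (le_abs_self _) (norm_nonneg _)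
        rw [Finset.sum_sub_distrib]
        simp only [Finset.sum_const, Finset.card_univ, Fintype.card_fin, nsmul_eq_mul]
        linarith

variable [MeasurableSpace B] [BorelSpace B] [SecondCountableTopology B]

theorem measurable_norm_sum_smul :
    Measurable fun p : (Fin n → B) × (Fin n → ℝ) => ‖∑ i, p.2 i • p.1 i‖ := by
  fun_prop

theorem measurable_rademacherMean : Measurable (rademacherMean : (Fin n → B) → ℝ) :=
  (measurable_norm_sum_smul.stronglyMeasurable.integral_prod_right').measurable

/-- The conditional Rademacher average is an explicit function of the conditioning variables. -/
theorem condRademacherAverage_ae_eq {Ω : Type*} [MeasurableSpace Ω] {μ : Measure Ω}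
    [IsProbabilityMeasure μ] {X : Fin n → Ω → B} {ε : Fin n → Ω → ℝ}
    (hX_meas : ∀ i, Measurable (X i)) {C : ℝ} (hX_bound : ∀ i, ∀ᵐ ω ∂μ, ‖X i ω‖ ≤ C)
    (hε : ∀ i, IsRademacher μ (ε i)) (hε_indep : iIndepFun ε μ)
    (hXε : IndepFun (fun ω i => X i ω) (fun ω i => ε i ω) μ) :
    condRademacherAverage μ X ε =ᵐ[μ] fun ω => rademacherMean fun i => X i ω := by
  have hXm : Measurable fun ω i => X i ω := measurable_pi_iff.2 hX_meas
  have hεm : Measurable fun ω i => ε i ω := measurable_pi_iff.2 fun i => (hε i).measurable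
  have hlaw : μ.map (fun ω i => ε i ω) = Measure.pi fun _ : Fin n => rademacherMeasure := by
    rw [(iIndepFun_iff_map_fun_eq_pi_map fun i => (hε i).measurable.aemeasurable).1 hε_indep]
    congr 1
    ext1 i
    exact (hε i).map_eq
  have hσ : (⨆ i, MeasurableSpace.comap (X i) inferInstance) =
      MeasurableSpace.comap (fun ω i => X i ω) MeasurableSpace.pi := by
    rw [MeasurableSpace.pi, MeasurableSpace.comap_iSup]
    simp only [MeasurableSpace.comap_comp, Function.comp_def]
  have hε1 : ∀ᵐ ω ∂μ, ∀ i, |ε i ω| = 1 := by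
    have := ae_pi_rademacherMeasure (n := n)
    rw [← hlaw] at this
    exact ae_of_ae_map hεm.aemeasurable this
  have hint : Integrable (fun ω => ‖∑ i, ε i ω • X i ω‖) μ := by
    refine Integrable.of_bound
      (measurable_norm_sum_smul.comp (hXm.prodMk hεm)).aestronglyMeasurable (n * C) ?_
    filter_upwards [hε1, ae_all_iff.2 hX_bound] with ω h1 h2
    rw [norm_norm]
    refine (norm_sum_smul_le h1 _).trans ((Finset.sum_le_sum fun i _ => h2 i).trans ?_)
    simp
  -- Independence makes the conditional law of the signs given `X` constant, so conditioning becomes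
  -- integration over the signs.
  have hcond : condDistrib (fun ω i => ε i ω) (fun ω i => X i ω) μ =ᵐ[μ.map fun ω i => X i ω]
      Kernel.const _ (Measure.pi fun _ : Fin n => rademacherMeasure) := by
    refine condDistrib_ae_eq_of_measure_eq_compProd _ hεm.aemeasurable ?_
    rw [(indepFun_iff_map_prod_eq_prod_map_map hXm.aemeasurable hεm.aemeasurable).1 hXε, hlaw,
      Measure.compProd_const]
  rw [condRademacherAverage, hσ]
  refine (condExp_prod_ae_eq_integral_condDistrib hXm hεm.aemeasurable
    measurable_norm_sum_smul.stronglyMeasurable hint).trans ?_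
  filter_upwards [ae_of_ae_map hXm.aemeasurable hcond] with ω hω
  rw [hω]
  rfl

end RademacherMean

/-! ### Assembly for the conditional Rademacher average. -/

theorem mainTheorem9 {Ω : Type*} [MeasurableSpace Ω] (μ : Measure Ω) [IsProbabilityMeasure μ]
    {B : Type*} [NormedAddCommGroup B] [NormedSpace ℝ B] [CompleteSpace B]
    [TopologicalSpace.SeparableSpace B] [MeasurableSpace B] [BorelSpace B]
    (n : ℕ) (hn : 1 ≤ n) (X : Fin n → Ω → B) (ε : Fin n → Ω → ℝ)
    (hX_meas : ∀ i, Measurable (X i))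
    (hX_indep : iIndepFun X μ)
    (hX_ident : ∀ i j, IdentDistrib (X i) (X j) μ μ)
    (hX_bound : ∀ i, ∀ᵐ ω ∂μ, ‖X i ω‖ ≤ 1)
    (hε : ∀ i, IsRademacher μ (ε i))
    (hε_indep : iIndepFun ε μ)
    (hXε : IndepFun (fun ω i => X i ω) (fun ω i => ε i ω) μ) :
    variance (condRademacherAverage μ X ε) μ ≤ ∫ ω, condRademacherAverage μ X ε ω ∂μ ∧
    (∀ t : ℝ, 0 < t →
      μ.real {ω | t ≤ condRademacherAverage μ X ε ω - ∫ ω', condRademacherAverage μ X ε ω' ∂μ} ≤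
        Real.exp (-(t ^ 2 / (2 * (variance (condRademacherAverage μ X ε) μ +
          (2 : ℝ) ^ (3 / 2 : ℝ) / 3 * t * Real.sqrt (n : ℝ)))))) ∧
    (∀ t : ℝ, 0 < t →
      μ.real {ω | t ≤ (-condRademacherAverage μ X ε) ω -
          ∫ ω', (-condRademacherAverage μ X ε) ω' ∂μ} ≤
        Real.exp (-(t ^ 2 / (2 * (variance (-condRademacherAverage μ X ε) μ +
          (2 : ℝ) ^ (3 / 2 : ℝ) / 3 * t * Real.sqrt (n : ℝ)))))) := by
  have : SecondCountableTopology B := UniformSpace.secondCountable_of_separable B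
  have hXm : Measurable fun ω i => X i ω := measurable_pi_iff.2 hX_meas
  -- Sending vectors outside the unit ball to `0` makes the bounds hold everywhere rather than
  -- almost everywhere, and almost surely leaves every `X i` unchanged.
  set φ : B → B := Set.indicator (Metric.closedBall 0 1) id with hφ
  have hφm : Measurable φ := measurable_id.indicator measurableSet_closedBall
  have hφ1 : ∀ b, ‖φ b‖ ≤ 1 := by
    intro b
    by_cases h : b ∈ Metric.closedBall (0 : B) 1
    · rw [hφ, Set.indicator_of_mem h]; simpa using h
    · rw [hφ, Set.indicator_of_notMem h]; simp
  have hΦm : Measurable fun (x : Fin n → B) i => φ (x i) := by fun_prop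
  set f : (Fin n → B) → ℝ := fun x => rademacherMean fun i => φ (x i) with hf
  set g : Fin n → (Fin n → B) → ℝ := fun i x =>
    rademacherMean (Function.update (fun j => φ (x j)) i 0) with hg
  have hfm : Measurable f := measurable_rademacherMean.comp hΦm
  have hgm : ∀ i, Measurable (g i) := fun i =>
    measurable_rademacherMean.comp <| measurable_pi_iff.2 fun j => by
      by_cases h : j = i
      · subst h; simp
      · simp only [Function.update_of_ne h]; fun_prop
  have hfn : ∀ x, f x ≤ n := fun x => (rademacherMean_le_sum_norm _).trans <|
    (Finset.sum_le_sum fun i _ => hφ1 (x i)).trans (by simp)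
  have hf0 : ∀ x, 0 ≤ f x := fun x => rademacherMean_nonneg _
  have hgf : ∀ i x, g i x ≤ f x := fun i x => rademacherMean_update_zero_le _ i
  have hfg : ∀ i x, f x ≤ g i x + 1 := fun i x =>
    (rademacherMean_le_update_zero_add _ i).trans (by gcongr; exact hφ1 _)
  have hg0 : ∀ i x, 0 ≤ g i x := fun i x => rademacherMean_nonneg _
  have hfC : ∀ x, |f x| ≤ n := fun x => by rw [abs_of_nonneg (hf0 x)]; exact hfn x
  have hgC : ∀ i x, |g i x| ≤ n := fun i x => by
    rw [abs_of_nonneg (hg0 i x)]; exact (hgf i x).trans (hfn x)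
  have hgi : ∀ i x a, g i (Function.update x i a) = g i x := by
    intro i x a
    simp only [hg]
    congr 1
    ext1 j
    by_cases h : j = i
    · subst h; simp
    · simp [h]
  have hosc : ∀ i x a b, f (Function.update x i a) - f (Function.update x i b) ≤ 1 := by
    intro i x a b
    have h1 := hfg i (Function.update x i a)
    have h2 := hgf i (Function.update x i b)
    rw [hgi] at h1 h2
    linarith
  have hν : ∀ i, IsProbabilityMeasure (μ.map (X i)) := fun i =>
    Measure.isProbabilityMeasure_map (hX_meas i).aemeasurable
  set π := Measure.pi fun i => μ.map (X i) with hπ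
  have hlaw : μ.map (fun ω i => X i ω) = π :=
    (iIndepFun_iff_map_fun_eq_pi_map fun i => (hX_meas i).aemeasurable).1 hX_indep
  have hR : condRademacherAverage μ X ε =ᵐ[μ] fun ω => f fun i => X i ω := by
    refine (condRademacherAverage_ae_eq hX_meas hX_bound hε hε_indep hXε).trans ?_
    filter_upwards [ae_all_iff.2 hX_bound] with ω hω
    simp only [hf]
    congr 1
    ext1 i
    rw [hφ, Set.indicator_of_mem (by simpa using hω i), id]
  set R := condRademacherAverage μ X ε with hRdef
  have hmean : ∫ ω, R ω ∂μ = ∫ x, f x ∂π := by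
    rw [integral_congr_ae hR, ← hlaw, integral_map hXm.aemeasurable hfm.aestronglyMeasurable]
  have hfi : Integrable f π := integrable_of_abs_le hfm hfC
  have hL : MemLp R 2 μ := (MemLp.of_bound (hfm.comp hXm).aestronglyMeasurable (n : ℝ)
    (ae_of_all _ fun ω => hfC _)).ae_eq hR.symm
  have hsg : HasSubgaussianMGF (fun ω => R ω - ∫ ω', R ω' ∂μ) n μ := by
    have h := hasSubgaussianMGF_pi_of_bounded_differences (fun i => μ.map (X i)) hfm hfC hosc
    rw [← hπ, ← hmean, ← hlaw] at h
    refine (HasSubgaussianMGF.of_map hXm.aemeasurable h).congr ?_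
    filter_upwards [hR] with ω hω
    simp [hω]
  refine ⟨?_, fun t ht => measureReal_le_exp_of_hasSubgaussianMGF hL hn hsg ht, fun t ht =>
    measureReal_le_exp_of_hasSubgaussianMGF hL.neg hn (hsg.neg.congr ?_) ht⟩
  -- The increment lies in `[0, 1]`, hence dominates its square.
  · have hsq : ∀ i x, (f x - g i x) ^ 2 ≤ f x - g i x := fun i x => by
      nlinarith [hgf i x, hfg i x]
    have hgint : ∀ i, Integrable (g i) π := fun i => integrable_of_abs_le (hgm i) (hgC i)
    calc variance R μ = ∫ x, (f x - ∫ y, f y ∂π) ^ 2 ∂π := by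
          rw [variance_congr hR, ← variance_eq_integral hfm.aemeasurable, ← hlaw,
            variance_map hfm.aemeasurable hXm.aemeasurable]
          rfl
      _ ≤ ∑ i, ∫ x, (f x - g i x) ^ 2 ∂π := efronStein_pi n _ hfm hfC hgm hgC hgi
      _ ≤ ∑ i, ∫ x, (f x - g i x) ∂π := by
          refine Finset.sum_le_sum fun i _ => integral_mono ?_ (hfi.sub (hgint i)) (hsq i)
          exact integrable_of_abs_le ((hfm.sub (hgm i)).pow_const 2)
            fun x => abs_sub_sq_le (hfC x) (hgC i x)
      _ = ∫ x, ∑ i, (f x - g i x) ∂π :=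
          (integral_finsetSum _ fun i _ => hfi.sub (hgint i)).symm
      _ ≤ ∫ x, f x ∂π :=
          integral_mono (integrable_finsetSum _ fun i _ => hfi.sub (hgint i)) hfi
            fun x => sum_rademacherMean_sub_update_zero_le _
      _ = ∫ ω, R ω ∂μ := hmean.symm
  · refine ae_of_all _ fun ω => ?_
    simp only [Pi.neg_apply, integral_neg]
    ring
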